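/- Let $A$ be a commutative ring with unit and let $\mathcal D(A)$ be its derived $\infty$-category, with homotopy groups $\pi_n K = H_n(K) = H^{-n}(K)$. A descending (resp. ascending) filtration of $A$-modules is a functor $C^\bullet\colon \mathbb Z^{\mathrm{op}}\to\mathcal D(A)$ (resp. $F_\bullet\colon\mathbb Z\to\mathcal D(A)$). Its graded pieces are $\mathrm{gr}^i C=\mathrm{cofib}(C^{i+1}\to C^i)$ (resp. $\mathrm{gr}^i F=\mathrm{cofib}(F_{i-1}\to F_i)$). It is called - *bounded* if $C^k\simeq 0$ for all $k\gg 0$ and $C^k\to\mathrm{colim}_{\mathbb Z^{\mathrm{op}}} C^\bullet$ is an equivalence for all $k\ll 0$ (resp. $F_k\simeq 0$ for all $k\ll 0$ and $F_k\to\mathrm{colim}_{\mathbb Z} F_\bullet$ is an equivalence for all $k\gg 0$); - *perfect* if every term is a perfect complex, i.e. quasi-isomorphic to a bounded complex of finitely generated projective $A$-modules; - *strong* if for all $j\le i$ the map $C^i\to C^j$ (resp. for all $i\le j$ the map $F_i\to F_j$) is injective on $\pi_n$ for every $n\in\mathbb Z$. **Proposition.** Let $C^\bullet$ be a bounded perfect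 descending filtration of $A$-modules such that the $A$-module $\pi_i\,\mathrm{gr}^k C$ is finite projective for all $i,k\in\mathbb Z$. Assume that the spectral sequence $$E_1^{p,q}=\pi_{p+q}\,\mathrm{gr}^pC\Longrightarrow \pi_{p+q}\,\mathrm{colim}_{\mathbb Z^{\mathrm{op}}}C^\bullet,\qquad d_r\colon E_r^{p,q}\to E_r^{p+r,\,q-r-1},$$ associated to $C^\bullet$, in which $$E_r^{p,q}=\mathrm{im}\bigl(\pi_{p+q}\,\mathrm{cofib}(C^{p+r}\to C^p)\to\pi_{p+q}\,\mathrm{cofib}(C^{p+1}\to C^{p-r+1})\bigr),$$ degenerates, i.e. $d_r=0$ for all $r\ge 1$. Then $C^\bullet$ is strong. Likewise, let $F_\bullet$ be a bounded perfect ascending filtration of $A$-modules such that $\pi_i\,\mathrm{gr}^k F$ is finite projective for all $i,k\in\mathbb Z$. If the associated spectral sequence $$E_1^{p,q}=\pi_{p+q}\,\mathrm{gr}^pF\Longrightarrow \pi_{p+q}\,\mathrm{colim}_{\mathbb Z}F_\bullet,\qquad d_r\colon E_r^{p,q}\to E_r^{p-r,\,q+r-1},$$ with $E_r^{p,q}=\mathrm{im}\bigl(\pi_{p+q}\,\mathrm{cofib}(F_{p-r}\to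 F_p)\to\pi_{p+q}\,\mathrm{cofib}(F_{p-1}\to F_{p+r-1})\bigr)$, degenerates in the same sense, then $F_\bullet$ is strong. -/

import Mathlib

open CategoryTheory Limits

universe u

noncomputable section

/-- Complexes of `A`-modules, graded cohomologically. They model `A`-modules in the derived sense,
i.e. objects of the derived `∞`-category of `A`, whose equivalences are the quasi-isomorphisms. -/
abbrev Cpx (A : Type u) [CommRing A] : Type (u + 1) := CochainComplex (ModuleCat.{u} A) ℤ

/-- The `n`-th homotopy group `π_n K = H_n(K) = H^{-n}(K)`. -/
abbrev homotopyGroup {A : Type u} [CommRing A] (n : ℤ) (K : Cpx A) : ModuleCat.{u} A :=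
  K.homology (-n)

/-- The map induced by `f` on the `n`-th homotopy groups. -/
abbrev homotopyGroupMap {A : Type u} [CommRing A] (n : ℤ) {K L : Cpx A} (f : K ⟶ L) :
    homotopyGroup n K ⟶ homotopyGroup n L :=
  HomologicalComplex.homologyMap f (-n)

/-- A monomorphism of derived `A`-modules: a map that is injective on all homotopy groups. -/
def IsHomotopyMono {A : Type u} [CommRing A] {K L : Cpx A} (f : K ⟶ L) : Prop :=
  ∀ n : ℤ, Function.Injective (homotopyGroupMap n f)

/-- A perfect complex: one that is quasi-isomorphic to a bounded complex of finite projective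
modules. As bounded complexes of projectives are K-projective, an isomorphism in the derived
category is always induced by a quasi-isomorphism `P ⟶ K` of complexes. -/
def IsPerfectComplex {A : Type u} [CommRing A] (K : Cpx A) : Prop :=
  ∃ (P : Cpx A) (f : P ⟶ K), QuasiIso f ∧
    (∀ n : ℤ, Module.Finite A (P.X n) ∧ Module.Projective A (P.X n)) ∧
    ∃ a b : ℤ, ∀ n : ℤ, (n < a ∨ b < n) → IsZero (P.X n)

/-- An ascending filtration `⋯ ⟶ F_{n-1} ⟶ F_n ⟶ F_{n+1} ⟶ ⋯`. Every functor from `ℤ` to the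
derived `∞`-category of `A` is equivalent to one that is given by such a strict functor. -/
abbrev AscFiltration (A : Type u) [CommRing A] : Type (u + 1) := ℤ ⥤ Cpx A

/-- A descending filtration `⋯ ⟶ C^{n+1} ⟶ C^n ⟶ C^{n-1} ⟶ ⋯`. Every functor from `ℤᵒᵖ` to the
derived `∞`-category of `A` is equivalent to one that is given by such a strict functor. -/
abbrev DescFiltration (A : Type u) [CommRing A] : Type (u + 1) := ℤᵒᵖ ⥤ Cpx A

/-- The image of a spectral object in a pretriangulated category under a homological functor: the
connecting maps and the long exact sequences are those of the functorial distinguished triangles. -/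
def homologicalImage {C D : Type*} [Category C] [Category D] [HasZeroObject C] [HasShift C ℤ]
    [Preadditive C] [∀ n : ℤ, (shiftFunctor C n).Additive] [Pretriangulated C] [Abelian D]
    {ι : Type*} [Category ι] (X : Triangulated.SpectralObject C ι) (F : C ⥤ D)
    [F.IsHomological] [F.ShiftSequence ℤ] : Abelian.SpectralObject D ι where
  H n := X.ω₁ ⋙ F.shift n
  δ' n₀ n₁ h :=
    { app := fun E ↦ F.homologySequenceδ (X.ω₂.obj E) n₀ n₁ h
      naturality := fun _ _ φ ↦ F.homologySequenceδ_naturality _ _ (X.ω₂.map φ) n₀ n₁ h }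
  exact₁' n₀ n₁ h E :=
    (F.homologySequence_exact₁ _ (X.ω₂_obj_distinguished E) n₀ n₁ h).exact_toComposableArrows
  exact₂' n E :=
    (F.homologySequence_exact₂ _ (X.ω₂_obj_distinguished E) n).exact_toComposableArrows
  exact₃' n₀ n₁ h E :=
    (F.homologySequence_exact₃ _ (X.ω₂_obj_distinguished E) n₀ n₁ h).exact_toComposableArrows

/-- The spectral object attached to a diagram `F` of complexes indexed by a preorder: it sends
`i ≤ j` to the cohomology groups `H^n(cofib (F i ⟶ F j))`, with the connecting maps coming from the
cofiber sequences `cofib (F i ⟶ F j) ⟶ cofib (F i ⟶ F k) ⟶ cofib (F j ⟶ F k)`. -/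
def filtrationSpectralObject {A : Type u} [CommRing A] {ι : Type} [Preorder ι] (F : ι ⥤ Cpx A) :
    Abelian.SpectralObject (ModuleCat.{u} A) ι :=
  homologicalImage ((HomotopyCategory.spectralObjectMappingCone (ModuleCat.{u} A)).precomp F)
    (HomotopyCategory.homologyFunctor (ModuleCat.{u} A) (ComplexShape.up ℤ) 0)

namespace AscFiltration

variable {A : Type u} [CommRing A] (F : AscFiltration A)

/-- The graded piece `gr^i F = cofib (F_{i-1} ⟶ F_i)`. -/
def gr (i : ℤ) : Cpx A :=
  CochainComplex.mappingCone (F.map (homOfLE (by lia : i - 1 ≤ i)))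

/-- Bounded: `F_k ⟶ colim F` is an equivalence for `k ≫ 0`, and `F_k ≃ 0` for `k ≪ 0`. The
colimit is filtered, hence exact, so that the colimit of complexes is the homotopy colimit. -/
def IsBounded : Prop :=
  (∃ i : ℤ, ∀ k : ℤ, i ≤ k → QuasiIso (colimit.ι F k)) ∧
  (∃ i : ℤ, ∀ k : ℤ, k ≤ i → (F.obj k).Acyclic)

/-- All the `F_k` are perfect. -/
def IsPerfect : Prop := ∀ k : ℤ, IsPerfectComplex (F.obj k)

/-- All the maps `F_i ⟶ F_j` are monomorphisms. -/
def IsStrong : Prop := ∀ (i j : ℤ) (h : i ≤ j), IsHomotopyMono (F.map (homOfLE h))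

/-- The indices of the spectral sequence of an ascending filtration. In position `(p, q)` the
total homological degree is `p + q`, and `E_r^{p,q}` is the image of
`π_{p+q} cofib (F_{p-r} ⟶ F_p) ⟶ π_{p+q} cofib (F_{p-1} ⟶ F_{p+r-1})`.
The differential `d_r` goes from `(p, q)` to `(p - r, q + r - 1)`. -/
@[simps]
def spectralSequenceData :
    Abelian.SpectralObject.SpectralSequenceDataCore ℤ
      (fun r ↦ ComplexShape.up' ((-r, r - 1) : ℤ × ℤ)) 1 where
  deg pq := -(pq.1 + pq.2)
  i₀ r pq _ := pq.1 - r
  i₁ pq := pq.1 - 1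
  i₂ pq := pq.1
  i₃ r pq _ := pq.1 + r - 1
  le₀₁ r pq hr := by lia
  le₁₂ pq := by lia
  le₂₃ r pq hr := by lia
  hc := by rintro r pq _ rfl _; dsimp; lia
  hc₀₂ := by rintro r pq _ rfl _; dsimp; lia
  hc₁₃ := by rintro r pq _ rfl _; dsimp; lia
  antitone_i₀ r r' pq hr hrr' := by lia
  monotone_i₃ r r' pq hr hrr' := by lia
  i₀_prev := by rintro r r' pq _ rfl _ _; dsimp; lia
  i₃_next := by rintro r r' pq _ rfl _ _; dsimp; lia

instance (X : Abelian.SpectralObject (ModuleCat.{u} A) ℤ) :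
    X.HasSpectralSequence spectralSequenceData where
  isZero_H_obj_mk₁_i₀_le r r' pq hpq n hn hrr' hr := (hpq _ rfl).elim
  isZero_H_obj_mk₁_i₃_le r r' pq hpq n hn hrr' hr :=
    (hpq (pq - (-r, r - 1)) (by simp)).elim

/-- The spectral sequence `E_1^{p,q} = π_{p+q} gr^p F ⟹ π_{p+q} colim F`. -/
def spectralSequence :
    SpectralSequence (ModuleCat.{u} A) (fun r ↦ ComplexShape.up' ((-r, r - 1) : ℤ × ℤ)) 1 :=
  (filtrationSpectralObject F).spectralSequence spectralSequenceData

/-- The spectral sequence degenerates (at `E_1`): all its differentials vanish. -/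
def Degenerates : Prop :=
  ∀ (r : ℤ) (hr : 1 ≤ r) (x y : ℤ × ℤ), (F.spectralSequence.page r hr).d x y = 0

instance : spectralSequenceData.HasFirstPageComputation where
  hi₀₁ _ := rfl
  hi₂₃ pq := by
    change pq.1 = pq.1 + 1 - 1
    lia

/-- The terms of the first page: `E_1^{p,q} = π_{p+q} gr^p F`. -/
def firstPageIso (p q : ℤ) :
    (F.spectralSequence.page 1).X (p, q) ≅ homotopyGroup (p + q) (F.gr p) :=
  (filtrationSpectralObject F).spectralSequenceFirstPageXIso spectralSequenceData (p, q)
    (p - 1) p rfl rfl (-(p + q)) rfl ≪≫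
  (HomotopyCategory.homologyFunctorFactors (ModuleCat.{u} A) (ComplexShape.up ℤ)
    (-(p + q))).app (F.gr p)

end AscFiltration

namespace DescFiltration

variable {A : Type u} [CommRing A] (C : DescFiltration A)

/-- The graded piece `gr^i C = cofib (C^{i+1} ⟶ C^i)`. -/
def gr (i : ℤ) : Cpx A :=
  CochainComplex.mappingCone (C.map (homOfLE (by lia : i ≤ i + 1)).op)

/-- Bounded: `C^k ⟶ colim C` is an equivalence for `k ≪ 0`, and `C^k ≃ 0` for `k ≫ 0`. The
colimit is filtered, hence exact, so that the colimit of complexes is the homotopy colimit. -/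
def IsBounded : Prop :=
  (∃ i : ℤ, ∀ k : ℤ, k ≤ i → QuasiIso (colimit.ι C (Opposite.op k))) ∧
  (∃ i : ℤ, ∀ k : ℤ, i ≤ k → (C.obj (Opposite.op k)).Acyclic)

/-- All the `C^k` are perfect. -/
def IsPerfect : Prop := ∀ k : ℤ, IsPerfectComplex (C.obj (Opposite.op k))

/-- All the maps `C^i ⟶ C^j`, for `j ≤ i`, are monomorphisms. -/
def IsStrong : Prop := ∀ (i j : ℤ) (h : j ≤ i), IsHomotopyMono (C.map (homOfLE h).op)

/-- The indices of the spectral sequence of a descending filtration, seen as a functor on `ℤ` with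
the reversed order. In position `(p, q)` the total homological degree is `p + q`, and `E_r^{p,q}`
is the image of
`π_{p+q} cofib (C^{p+r} ⟶ C^p) ⟶ π_{p+q} cofib (C^{p+1} ⟶ C^{p-r+1})`.
The differential `d_r` goes from `(p, q)` to `(p + r, q - r - 1)`. -/
def spectralSequenceData :
    Abelian.SpectralObject.SpectralSequenceDataCore ℤᵒᵈ
      (fun r ↦ ComplexShape.up' ((r, -r - 1) : ℤ × ℤ)) 1 where
  deg pq := -(pq.1 + pq.2)
  i₀ r pq _ := OrderDual.toDual (pq.1 + r)
  i₁ pq := OrderDual.toDual (pq.1 + 1)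
  i₂ pq := OrderDual.toDual pq.1
  i₃ r pq _ := OrderDual.toDual (pq.1 - r + 1)
  le₀₁ r pq hr := OrderDual.toDual_le_toDual.2 (by lia)
  le₁₂ pq := OrderDual.toDual_le_toDual.2 (by lia)
  le₂₃ r pq hr := OrderDual.toDual_le_toDual.2 (by lia)
  hc := by rintro r pq _ rfl _; dsimp; lia
  hc₀₂ := by rintro r pq _ rfl _; rfl
  hc₁₃ := by rintro r pq _ rfl _; apply congrArg OrderDual.toDual; dsimp; lia
  antitone_i₀ r r' pq hr hrr' := OrderDual.toDual_le_toDual.2 (by lia)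
  monotone_i₃ r r' pq hr hrr' := OrderDual.toDual_le_toDual.2 (by lia)
  i₀_prev := by rintro r r' pq _ rfl _ _; apply congrArg OrderDual.toDual; dsimp; lia
  i₃_next := by rintro r r' pq _ rfl _ _; apply congrArg OrderDual.toDual; dsimp; lia

instance (X : Abelian.SpectralObject (ModuleCat.{u} A) ℤᵒᵈ) :
    X.HasSpectralSequence spectralSequenceData where
  isZero_H_obj_mk₁_i₀_le r r' pq hpq n hn hrr' hr := (hpq _ rfl).elim
  isZero_H_obj_mk₁_i₃_le r r' pq hpq n hn hrr' hr :=
    (hpq (pq - (r, -r - 1)) (by simp)).elim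

/-- The spectral sequence `E_1^{p,q} = π_{p+q} gr^p C ⟹ π_{p+q} colim C`. -/
def spectralSequence :
    SpectralSequence (ModuleCat.{u} A) (fun r ↦ ComplexShape.up' ((r, -r - 1) : ℤ × ℤ)) 1 :=
  (filtrationSpectralObject ((orderDualEquivalence ℤ).functor ⋙ C)).spectralSequence
    spectralSequenceData

/-- The spectral sequence degenerates (at `E_1`): all its differentials vanish. -/
def Degenerates : Prop :=
  ∀ (r : ℤ) (hr : 1 ≤ r) (x y : ℤ × ℤ), (C.spectralSequence.page r hr).d x y = 0

instance : spectralSequenceData.HasFirstPageComputation where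
  hi₀₁ _ := rfl
  hi₂₃ pq := congrArg OrderDual.toDual (by lia)

/-- The terms of the first page: `E_1^{p,q} = π_{p+q} gr^p C`. -/
def firstPageIso (p q : ℤ) :
    (C.spectralSequence.page 1).X (p, q) ≅ homotopyGroup (p + q) (C.gr p) :=
  (filtrationSpectralObject
      ((orderDualEquivalence ℤ).functor ⋙ C)).spectralSequenceFirstPageXIso
    spectralSequenceData (p, q)
    (OrderDual.toDual (p + 1)) (OrderDual.toDual p) rfl rfl (-(p + q)) rfl ≪≫
  (HomotopyCategory.homologyFunctorFactors (ModuleCat.{u} A) (ComplexShape.up ℤ)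
    (-(p + q))).app (C.gr p)

end DescFiltration

end

open Abelian

/-! The obstruction to injectivity of `H^n(F_{j-1}) ⟶ H^n(F_j)` is the connecting map out of
`H^{n-1}(gr^j F)`. Approximate it by the connecting maps δ_r from `H^{n-1}(gr^j F)` to `H^n(cofib
(F_{j-r} ⟶ F_{j-1}))`. For r = 1 the target is zero. If δ_r = 0, then every class of `gr^j F` lives
to page r, and `d_r` is what obstructs δ_{r+1} = 0; so degeneration gives δ_r = 0 for all r by
induction. Once `F_{j-r}` is acyclic, the target of δ_r is `H^n(F_{j-1})` and injectivity follows
from the long exact sequence. Composing consecutive steps gives strength. The descending case is the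
same over the reversed order. -/

namespace CategoryTheory.Abelian.SpectralObject

/-! ### Connecting maps and differentials of a spectral object -/

section

variable {C ι : Type*} [Category* C] [Abelian C] [Category* ι] (X : SpectralObject C ι)

/-- If the differential leaving `E(f₃, f₄, f₅)` vanishes and every class of `H(f₄)` survives to
this page, then every class of `H(f₄)` also survives to the next page. -/
lemma δ_comp_eq_zero_of_d_eq_zero {i₀ i₁ i₂ i₃ i₄ i₅ : ι} (f₁ : i₀ ⟶ i₁) (f₂ : i₁ ⟶ i₂)
    (f₃ : i₂ ⟶ i₃) (f₄ : i₃ ⟶ i₄) (f₅ : i₄ ⟶ i₅) (n₀ n₁ n₂ n₃ : ℤ)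
    (hn₁ : n₀ + 1 = n₁) (hn₂ : n₁ + 1 = n₂) (hn₃ : n₂ + 1 = n₃)
    (hd : X.d f₁ f₂ f₃ f₄ f₅ n₀ n₁ n₂ n₃ hn₁ hn₂ hn₃ = 0)
    (hδ : X.δ f₃ f₄ n₁ n₂ hn₂ = 0) :
    X.δ (f₂ ≫ f₃) f₄ n₁ n₂ hn₂ = 0 := by
  -- `Ψ` is the differential preceded by the projection from cycles to `E` and followed by the
  -- inclusion of `E` into opcycles.
  have hΨ : X.Ψ f₂ f₃ f₄ n₁ n₂ hn₂ = 0 := by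
    rw [← X.πE_d_ιE f₁ f₂ f₃ f₄ f₅ n₀ n₁ n₂ n₃ hn₁ hn₂ hn₃, hd, zero_comp, comp_zero]
  have h := X.Ψ_fromOpcycles f₂ f₃ f₄ (f₂ ≫ f₃) rfl n₁ n₂ hn₂
  rw [hΨ, zero_comp] at h
  -- The cycles are the kernel of `δ f₃ f₄ = 0`, so the identity of `H(f₄)` lifts to them and δ can
  -- be computed through `Ψ`.
  rw [← Category.id_comp (X.δ (f₂ ≫ f₃) f₄ n₁ n₂ hn₂),
    ← X.liftCycles_i f₃ f₄ n₁ n₂ hn₂ (𝟙 _) (by rw [hδ, comp_zero]), Category.assoc, ← h,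
    comp_zero]

end

section

variable {C ι κ : Type*} [Category* C] [Abelian C] [Preorder ι] (X : SpectralObject C ι)
  {c : ℤ → ComplexShape κ} {r₀ : ℤ} (data : SpectralSequenceDataCore ι c r₀)
  [X.HasSpectralSequence data] [data.HasFirstPageComputation]

/-- If all the differentials of the spectral sequence vanish, then every class of the first page
survives to all pages. -/
lemma δ_eq_zero_of_page_d_eq_zero
    (hd : ∀ (r : ℤ) (hr : r₀ ≤ r) (x y : κ), ((X.spectralSequence data).page r hr).d x y = 0)
    (pq : κ) (hc : ∀ r, r₀ ≤ r → ∃ pq', (c r).Rel pq pq')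
    (n₁ n₂ : ℤ) (hn₁ : n₁ = data.deg pq) (hn₂ : n₁ + 1 = n₂) (r : ℤ) (hr : r₀ ≤ r) :
    X.δ (homOfLE (data.le₀₁ r pq)) (homOfLE (data.le₁₂ pq)) n₁ n₂ hn₂ = 0 := by
  induction r, hr using Int.leInduction with
  | base =>
    -- On the first page `i₀ = i₁`, so the target of δ is the zero object `H` of an isomorphism.
    have : IsIso (homOfLE (data.le₀₁ r₀ pq)) := by
      have e := SpectralSequenceDataCore.HasFirstPageComputation.hi₀₁ (data := data) pq
      exact ⟨homOfLE e.ge, Subsingleton.elim _ _, Subsingleton.elim _ _⟩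
    exact X.δ_eq_zero_of_isIso₁ _ _ this _ _ _
  | succ r hr ih =>
    obtain ⟨pq', hpq⟩ := hc r hr
    have e₁ := data.i₀_prev r (r + 1) pq pq' hpq
    have e₂ := data.hc₀₂ r pq pq' hpq
    have h := hd r hr pq pq'
    rw [X.spectralSequence_page_d_eq data r hr pq pq' hpq
      (homOfLE (e₁ ▸ data.le₀₁ r pq' hr)) (homOfLE (data.i₀_le r (r + 1) pq))
      (homOfLE (data.le₀₁ r pq)) (homOfLE (data.le₁₂ pq)) (homOfLE (data.le₂₃ r pq))
      rfl e₁ rfl rfl rfl rfl (n₁ - 1) n₁ n₂ (n₂ + 1) hn₁ (by lia) hn₂ rfl] at h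
    -- The page differential is the spectral object's `d` up to isomorphisms at both ends.
    rw [Preadditive.IsIso.comp_left_eq_zero, Preadditive.IsIso.comp_right_eq_zero] at h
    exact X.δ_comp_eq_zero_of_d_eq_zero _ _ _ _ _ _ _ _ _ _ _ _ h ih

end

end CategoryTheory.Abelian.SpectralObject

/-! ### Injectivity on the homology of filtered complexes -/

section

variable {A : Type u} [CommRing A]

/-- The map `L ⟶ cofib φ` is injective on homology if the source of `φ` is acyclic. -/
lemma mono_homologyMap_mappingCone_inr {K L : Cpx A} (φ : K ⟶ L) (hK : K.Acyclic) (n : ℤ) :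
    Mono ((HomotopyCategory.homologyFunctor (ModuleCat.{u} A) (ComplexShape.up ℤ) n).map
      ((HomotopyCategory.quotient _ _).map (CochainComplex.mappingCone.inr φ))) := by
  let H := HomotopyCategory.homologyFunctor (ModuleCat.{u} A) (ComplexShape.up ℤ)
  have h := (H n).map_distinguished_exact _
    (HomotopyCategory.mappingCone_triangleh_distinguished φ)
  refine h.mono_g (IsZero.eq_of_src ?_ _ _)
  exact ((HomologicalComplex.exactAt_iff_isZero_homology _ _).1 (hK n)).of_iso
    ((HomotopyCategory.homologyFunctorFactors (ModuleCat.{u} A) (ComplexShape.up ℤ) n).app K)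

/-- If the classes of the graded piece `H(i ≤ j)` map to zero in `H(k ≤ i)`, where `F k` is
acyclic, then `F i ⟶ F j` is injective on homology. -/
lemma mono_homologyMap_of_δ_eq_zero {ι : Type} [Preorder ι] (F : ι ⥤ Cpx A) {k i j : ι}
    (hki : k ≤ i) (hij : i ≤ j) (hk : (F.obj k).Acyclic) (n₀ n : ℤ) (hn : n₀ + 1 = n)
    (hδ : (filtrationSpectralObject F).δ (homOfLE hki) (homOfLE hij) n₀ n hn = 0) :
    Mono (HomologicalComplex.homologyMap (F.map (homOfLE hij)) n) := by
  let H := HomotopyCategory.homologyFunctor (ModuleCat.{u} A) (ComplexShape.up ℤ) n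
  let Q := HomotopyCategory.quotient (ModuleCat.{u} A) (ComplexShape.up ℤ)
  have comm : F.map (homOfLE hki) ≫ F.map (homOfLE hij) =
      F.map (𝟙 k) ≫ F.map (homOfLE (hki.trans hij)) := by
    rw [← F.map_comp, ← F.map_comp]; rfl
  let γ := CochainComplex.mappingCone.map (F.map (homOfLE hki))
    (F.map (homOfLE (hki.trans hij))) (F.map (𝟙 k)) (F.map (homOfLE hij)) comm
  have hγ : Mono (H.map (Q.map γ)) :=
    ((filtrationSpectralObject F).exact₁ (homOfLE hki) (homOfLE hij)
      (homOfLE (hki.trans hij)) rfl n₀ n hn).mono_g hδ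
  have hinr : Mono (H.map (Q.map (CochainComplex.mappingCone.inr (F.map (homOfLE hki))))) :=
    mono_homologyMap_mappingCone_inr (F.map (homOfLE hki)) hk n
  -- Both maps on the left are injective on homology, hence so is the first factor on the right.
  have fac : CochainComplex.mappingCone.inr (F.map (homOfLE hki)) ≫ γ =
      F.map (homOfLE hij) ≫ CochainComplex.mappingCone.inr (F.map (homOfLE (hki.trans hij))) :=
    CochainComplex.mappingCone.inr_desc ..
  have hF : Mono (H.map (Q.map (F.map (homOfLE hij)))) := by
    have h : Mono (H.map (Q.map (F.map (homOfLE hij))) ≫ H.map (Q.map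
        (CochainComplex.mappingCone.inr (F.map (homOfLE (hki.trans hij)))))) := by
      rw [← Functor.map_comp, ← Functor.map_comp, ← fac, Functor.map_comp, Functor.map_comp]
      exact mono_comp _ _
    exact mono_of_mono _ (H.map (Q.map
      (CochainComplex.mappingCone.inr (F.map (homOfLE (hki.trans hij))))))
  exact ((MorphismProperty.monomorphisms _).arrow_mk_iso_iff
    (Arrow.isoOfNatIso (HomotopyCategory.homologyFunctorFactors (ModuleCat.{u} A)
      (ComplexShape.up ℤ) n) (Arrow.mk (F.map (homOfLE hij))))).1 hF

lemma isHomotopyMono_of_mono {K L : Cpx A} {f : K ⟶ L}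
    (hf : ∀ n, Mono (HomologicalComplex.homologyMap f n)) : IsHomotopyMono f := fun n ↦
  (ModuleCat.mono_iff_injective _).1 (hf (-n))

lemma isHomotopyMono_id (K : Cpx A) : IsHomotopyMono (𝟙 K) :=
  isHomotopyMono_of_mono fun _ ↦ inferInstance

lemma IsHomotopyMono.comp {K L M : Cpx A} {f : K ⟶ L} {g : L ⟶ M} (hf : IsHomotopyMono f)
    (hg : IsHomotopyMono g) : IsHomotopyMono (f ≫ g) := fun n ↦ by
  have := (ModuleCat.mono_iff_injective _).2 (hf n)
  have := (ModuleCat.mono_iff_injective _).2 (hg n)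
  rw [← ModuleCat.mono_iff_injective, homotopyGroupMap, HomologicalComplex.homologyMap_comp]
  exact mono_comp _ _

/-! ### Ascending filtrations -/

namespace AscFiltration

variable (F : AscFiltration A)

lemma isHomotopyMono_succ_of_degenerates {m : ℤ} (hm : ∀ k ≤ m, (F.obj k).Acyclic)
    (hd : F.Degenerates) {i j : ℤ} (hij : i + 1 = j) :
    IsHomotopyMono (F.map (homOfLE (by lia : i ≤ j))) := by
  obtain rfl : i = j - 1 := by lia
  refine isHomotopyMono_of_mono fun n ↦ ?_
  -- The second index is chosen so that `gr^j` sits in cohomological degree `n - 1`; `r = max 1 (j -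
  -- m)` is a legal page with `j - r ≤ m`, where `F` is acyclic.
  have hδ := (filtrationSpectralObject F).δ_eq_zero_of_page_d_eq_zero spectralSequenceData hd
    (j, 1 - n - j) (fun r _ ↦ ⟨_, rfl⟩) (n - 1) n (by dsimp [spectralSequenceData]; lia) (by lia)
    (max 1 (j - m)) (by lia)
  exact mono_homologyMap_of_δ_eq_zero F _ _ (hm (j - max 1 (j - m)) (by lia)) _ _ _ hδ

lemma isStrong_of_degenerates {m : ℤ} (hm : ∀ k ≤ m, (F.obj k).Acyclic)
    (hd : F.Degenerates) : F.IsStrong := fun i j h ↦ by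
  induction j, h using Int.leInduction with
  | base =>
    have e : F.map (homOfLE (le_refl i)) = 𝟙 _ := F.map_id i
    rw [e]
    exact isHomotopyMono_id _
  | succ j h ih =>
    have e : F.map (homOfLE (by lia : i ≤ j + 1)) =
        F.map (homOfLE h) ≫ F.map (homOfLE (by lia : j ≤ j + 1)) := by
      rw [← F.map_comp]; rfl
    rw [e]
    exact ih.comp (F.isHomotopyMono_succ_of_degenerates hm hd rfl)

end AscFiltration

/-! ### Descending filtrations -/

namespace DescFiltration

variable (C : DescFiltration A)

lemma isHomotopyMono_succ_of_degenerates {m : ℤ}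
    (hm : ∀ k, m ≤ k → (C.obj (Opposite.op k)).Acyclic) (hd : C.Degenerates) (i : ℤ) :
    IsHomotopyMono (C.map (homOfLE (by lia : i ≤ i + 1)).op) := by
  refine isHomotopyMono_of_mono fun n ↦ ?_
  -- In the reversed order `i + r` is the lowest index, and `r = max 1 (m - i)` pushes it into the
  -- acyclic range `≥ m`.
  have hδ := (filtrationSpectralObject
      ((orderDualEquivalence ℤ).functor ⋙ C)).δ_eq_zero_of_page_d_eq_zero spectralSequenceData hd
    (i, 1 - n - i) (fun r _ ↦ ⟨_, rfl⟩) (n - 1) n (by dsimp [spectralSequenceData]; lia) (by lia)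
    (max 1 (m - i)) (by lia)
  exact mono_homologyMap_of_δ_eq_zero ((orderDualEquivalence ℤ).functor ⋙ C) _ _
    (hm (i + max 1 (m - i)) (by lia)) _ _ _ hδ

lemma isStrong_of_degenerates {m : ℤ}
    (hm : ∀ k, m ≤ k → (C.obj (Opposite.op k)).Acyclic) (hd : C.Degenerates) :
    C.IsStrong := fun i j h ↦ by
  induction i, h using Int.leInduction with
  | base =>
    have e : C.map (homOfLE (le_refl j)).op = 𝟙 _ := C.map_id _
    rw [e]
    exact isHomotopyMono_id _
  | succ i h ih =>
    have e : C.map (homOfLE (by lia : j ≤ i + 1)).op =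
        C.map (homOfLE (by lia : i ≤ i + 1)).op ≫ C.map (homOfLE h).op := by
      rw [← C.map_comp]; rfl
    rw [e]
    exact (C.isHomotopyMono_succ_of_degenerates hm hd i).comp ih

end DescFiltration

end

theorem proposition3p52 (A : Type u) [CommRing A] :
    (∀ C : DescFiltration A, C.IsBounded → C.IsPerfect →
      (∀ i k : ℤ, Module.Finite A (homotopyGroup i (C.gr k)) ∧
        Module.Projective A (homotopyGroup i (C.gr k))) →
      C.Degenerates → C.IsStrong) ∧
    (∀ F : AscFiltration A, F.IsBounded → F.IsPerfect →
      (∀ i k : ℤ, Module.Finite A (homotopyGroup i (F.gr k)) ∧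
        Module.Projective A (homotopyGroup i (F.gr k))) →
      F.Degenerates → F.IsStrong) :=
  ⟨fun C ⟨_, _, hm⟩ _ _ hd ↦ C.isStrong_of_degenerates hm hd,
    fun F ⟨_, _, hm⟩ _ _ hd ↦ F.isStrong_of_degenerates hm hd⟩
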